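/- Let $f\colon(0,\infty)\to\mathbb{R}$ be convex and differentiable with $f(1)=0$. For probability measures $P,Q$ on a common measurable space $(\mathcal{A},\mathscr{F})$ with densities $p,q$ with respect to a dominating measure $\mu$ (e.g. $\mu=P+Q$), let $$D_f(P\|Q)=\int q\,f\!\left(\frac{p}{q}\right)d\mu\in(-\infty,\infty],\qquad f(0):=\lim_{t\downarrow0}f(t),\quad 0f\!\left(\tfrac00\right):=0,\quad 0f\!\left(\tfrac a0\right):=\lim_{t\downarrow0}t f\!\left(\tfrac at\right)\ (a>0)$$ be the $f$-divergence (defined in the same way for every convex function on $(0,\infty)$ vanishing at $1$). For $\gamma\ge1$ let $$E_\gamma(P\|Q)=\max_{\mathcal{U}\in\mathscr{F}}\bigl(P(\mathcal{U})-\gamma\,Q(\mathcal{U})\bigr),$$ and for $\omega\in(0,1)$ let $\mathcal{I}_\omega(P\|Q)=D_{\phi_\omega}(P\|Q)$ be the DeGroot statistical information, where $\phi_\omega(t)=\min\{\omega,1-\omega\}-\min\{\omega t,1-\omega\}$ for $t>0$. Then, for mutually absolutely continuous $P$ and $Q$, the divergence $D_f(P\|Q)$ is determined by the family of pairs $\bigl(E_\gamma(P\|Q),E_\gamma(Q\|P)\bigr)$,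 indexed by $\gamma\ge1$, and it is also determined by the family $\mathcal{I}_\omega(P\|Q)$, indexed by $\omega\in(0,1)$. That is, let $P,Q$ be mutually absolutely continuous probability measures on a measurable space, and let $P',Q'$ be mutually absolutely continuous probability measures on a possibly different measurable space. (a) If $E_\gamma(P\|Q)=E_\gamma(P'\|Q')$ and $E_\gamma(Q\|P)=E_\gamma(Q'\|P')$ for all $\gamma\ge1$, then $D_f(P\|Q)=D_f(P'\|Q')$. (b) If $\mathcal{I}_\omega(P\|Q)=\mathcal{I}_\omega(P'\|Q')$ for all $\omega\in(0,1)$, then $D_f(P\|Q)=D_f(P'\|Q')$. -/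

import Mathlib

open MeasureTheory Filter Set Topology
open scoped ENNReal

noncomputable section

/-- The class of convex functions `f : (0, ∞) → ℝ` with `f 1 = 0`. Such a function is represented
by a function on `ℝ` whose values outside `(0, ∞)` play no role. -/
def DivergenceFun (f : ℝ → ℝ) : Prop :=
  ConvexOn ℝ (Ioi 0) f ∧ f 1 = 0

/-- The extended real number `b f(a / b)` for `a, b ≥ 0`, with the conventions
`f 0 = lim_{t ↓ 0} f t`, `0 f(0 / 0) = 0` and `0 f(a / 0) = lim_{t ↓ 0} t f(a / t)` for `a > 0`.
The limits are taken in `[-∞, ∞]`, where they exist for every convex `f`. -/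
def persp (f : ℝ → ℝ) (a b : ℝ) : EReal :=
  if b = 0 then
    if a = 0 then 0 else limUnder (𝓝[>] (0 : ℝ)) fun t : ℝ => ((t * f (a / t) : ℝ) : EReal)
  else
    if a = 0 then (b : EReal) * limUnder (𝓝[>] (0 : ℝ)) fun t : ℝ => ((f t : ℝ) : EReal)
    else ((b * f (a / b) : ℝ) : EReal)

/-- The Lebesgue integral of an extended-real-valued function: the integral of the positive part
minus the integral of the negative part. -/
def extIntegral {α : Type*} [MeasurableSpace α] (μ : Measure α) (F : α → EReal) : EReal :=
  ((∫⁻ x, (F x).toENNReal ∂μ : ℝ≥0∞) : EReal) - ((∫⁻ x, (-F x).toENNReal ∂μ : ℝ≥0∞) : EReal)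

/-- The `f`-divergence `D_f(P‖Q) = ∫ q f(p / q) dμ`, where `p` and `q` are the densities of `P`
and `Q` with respect to the dominating measure `μ = P + Q`. Its value is an extended real. -/
def fDivergence {α : Type*} [MeasurableSpace α] (f : ℝ → ℝ) (P Q : Measure α) : EReal :=
  extIntegral (P + Q) fun x =>
    persp f (P.rnDeriv (P + Q) x).toReal (Q.rnDeriv (P + Q) x).toReal

/-- The `E_γ` divergence: the supremum of `P(U) - γ Q(U)` over all events `U`. -/
def eGamma {α : Type*} [MeasurableSpace α] (γ : ℝ) (P Q : Measure α) : ℝ :=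
  ⨆ U : {U : Set α // MeasurableSet U}, (P.real U.1 - γ * Q.real U.1)

/-- The function `φ_ω(t) = min {ω, 1 - ω} - min {ω t, 1 - ω}`. -/
def deGrootFun (ω t : ℝ) : ℝ := min ω (1 - ω) - min (ω * t) (1 - ω)

/-- The DeGroot statistical information `I_ω(P‖Q)`: the `f`-divergence for `f = φ_ω`. -/
def deGrootInfo {α : Type*} [MeasurableSpace α] (ω : ℝ) (P Q : Measure α) : EReal :=
  fDivergence (deGrootFun ω) P Q

end

/-! Let X = dP/d(P+Q). Mutual absolute continuity puts X in (0,1) almost everywhere, and dQ/d(P+Q) =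
1 - X. So D_f is the integral of (1-x) f(x/(1-x)) against the law of X under P+Q
(`fDivergence_eq_extIntegral_likelihoodLaw`), and it suffices to recover this law. A finite measure
with finite mean is determined by its integrals of (x-c)⁺ (`measure_eq_of_integral_max_sub`). Here
only c in (0,1) carries information. Up to explicit factors and constants, E_γ(P‖Q) is this integral
at c = γ/(1+γ), which covers [1/2,1); E_γ(Q‖P) covers the rest by the symmetry X ↦ 1-X; and I_ω is
the integral at c = 1-ω. -/

/-- The extended integral of an integrable real function is its Bochner integral. -/
theorem extIntegral_coe_of_integrable {α : Type*} [MeasurableSpace α] {μ : Measure α}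
    {g : α → ℝ} (hg : Integrable g μ) :
    extIntegral μ (fun x => (g x : EReal)) = ((∫ x, g x ∂μ : ℝ) : EReal) := by
  have hfin : ∀ {h : α → ℝ}, Integrable h μ → ∫⁻ x, ENNReal.ofReal (h x) ∂μ ≠ ∞ := fun hh =>
    ((lintegral_mono fun x => Real.ofReal_le_enorm _).trans_lt hh.2).ne
  have h1 := hfin hg
  have h2 := hfin hg.neg
  simp only [Pi.neg_apply] at h2
  have key : extIntegral μ (fun x => (g x : EReal)) =
      ((∫⁻ x, ENNReal.ofReal (g x) ∂μ : ℝ≥0∞) : EReal) -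
      ((∫⁻ x, ENNReal.ofReal (-g x) ∂μ : ℝ≥0∞) : EReal) := by
    unfold extIntegral
    simp only [← EReal.coe_neg, EReal.toENNReal_of_ne_top (EReal.coe_ne_top _), EReal.toReal_coe]
  rw [key, integral_eq_lintegral_pos_part_sub_lintegral_neg_part hg, EReal.coe_sub,
    EReal.coe_ennreal_toReal h1, EReal.coe_ennreal_toReal h2]

theorem extIntegral_congr_ae {α : Type*} [MeasurableSpace α] {μ : Measure α}
    {F G : α → EReal} (h : F =ᵐ[μ] G) : extIntegral μ F = extIntegral μ G := by
  unfold extIntegral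
  congr 2
  · exact lintegral_congr_ae (h.mono fun x hx => by simp only [hx])
  · exact lintegral_congr_ae (h.mono fun x hx => by simp only [hx])

theorem extIntegral_map {α β : Type*} [MeasurableSpace α] [MeasurableSpace β] {μ : Measure α}
    {φ : α → β} (hφ : Measurable φ) {F : β → EReal} (hF : Measurable F) :
    extIntegral (μ.map φ) F = extIntegral μ (fun x => F (φ x)) := by
  unfold extIntegral
  rw [lintegral_map hF.ereal_toENNReal hφ, lintegral_map (f := fun y => (-F y).toENNReal) hF.neg.ereal_toENNReal hφ]

/-- The normalized likelihood `dP / d(P + Q)`, as a real function. -/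
noncomputable def likelihood {α : Type*} [MeasurableSpace α] (P Q : Measure α) (x : α) : ℝ :=
  (P.rnDeriv (P + Q) x).toReal

/-- The law of `dP / d(P + Q)` under `P + Q`. -/
noncomputable def likelihoodLaw {α : Type*} [MeasurableSpace α] (P Q : Measure α) : Measure ℝ :=
  (P + Q).map (likelihood P Q)

/-! ### Recovering a measure on the line from its integrals of (x-c)⁺ -/

/-- Integrals of the functions `(x - c)⁺` determine a finite measure on the line. -/
theorem measure_eq_of_integral_max_sub {μ ν : Measure ℝ} [IsFiniteMeasure μ] [IsFiniteMeasure ν]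
    (hμ : Integrable (fun x : ℝ => x) μ) (hν : Integrable (fun x : ℝ => x) ν)
    (h : ∀ c : ℝ, ∫ x, max (x - c) 0 ∂μ = ∫ x, max (x - c) 0 ∂ν) : μ = ν := by
  -- The tail ρ(c,∞) is minus the right derivative of c ↦ ∫ (x-c)⁺ dρ: the difference quotients of
  -- the integrand lie in [0,1] and tend to the indicator of (c,∞), so dominated convergence
  -- applies.
  have lim : ∀ (ρ : Measure ℝ) [IsFiniteMeasure ρ], Integrable (fun x : ℝ => x) ρ → ∀ c : ℝ,
      Tendsto (fun n : ℕ => ((n : ℝ) + 1) * ((∫ x, max (x - c) 0 ∂ρ) -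
        ∫ x, max (x - (c + 1 / ((n : ℝ) + 1))) 0 ∂ρ)) atTop (𝓝 (ρ.real (Ioi c))) := by
    intro ρ _ hρ c
    have hint : ∀ c : ℝ, Integrable (fun x : ℝ => max (x - c) 0) ρ := fun c =>
      (hρ.sub (integrable_const c)).pos_part
    have hrw : ρ.real (Ioi c) = ∫ x, (Ioi c).indicator (fun _ => (1 : ℝ)) x ∂ρ := by
      rw [integral_indicator measurableSet_Ioi]; simp
    have hrw2 : ∀ n : ℕ, ((n : ℝ) + 1) * ((∫ x, max (x - c) 0 ∂ρ) -
        ∫ x, max (x - (c + 1 / ((n : ℝ) + 1))) 0 ∂ρ) =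
        ∫ x, ((n : ℝ) + 1) * (max (x - c) 0 - max (x - (c + 1 / ((n : ℝ) + 1))) 0) ∂ρ := by
      intro n
      rw [integral_const_mul, integral_sub (hint _) (hint _)]
    simp_rw [hrw, hrw2]
    refine tendsto_integral_of_dominated_convergence (fun _ => (1 : ℝ)) (fun n => ?_)
      (integrable_const _) (fun n => ?_) ?_
    · exact (by fun_prop : Measurable fun x : ℝ => ((n : ℝ) + 1) *
        (max (x - c) 0 - max (x - (c + 1 / ((n : ℝ) + 1))) 0)).aestronglyMeasurable
    · refine ae_of_all _ fun x => ?_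
      have hn : (0 : ℝ) < (n : ℝ) + 1 := by positivity
      have he : (0 : ℝ) < 1 / ((n : ℝ) + 1) := by positivity
      have h0 : 0 ≤ max (x - c) 0 - max (x - (c + 1 / ((n : ℝ) + 1))) 0 := by
        rw [sub_nonneg]; exact max_le_max (by linarith) le_rfl
      have h1 : max (x - c) 0 - max (x - (c + 1 / ((n : ℝ) + 1))) 0 ≤ 1 / ((n : ℝ) + 1) := by
        rcases max_cases (x - c) 0 with h | h <;>
        rcases max_cases (x - (c + 1 / ((n : ℝ) + 1))) 0 with h' | h' <;> linarith
      rw [Real.norm_of_nonneg (mul_nonneg hn.le h0)]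
      calc _ ≤ ((n : ℝ) + 1) * (1 / ((n : ℝ) + 1)) := mul_le_mul_of_nonneg_left h1 hn.le
        _ = 1 := by field_simp
    · refine ae_of_all _ fun x => ?_
      by_cases hx : c < x
      · rw [indicator_of_mem (mem_Ioi.2 hx)]
        refine tendsto_const_nhds.congr' ?_
        have := (tendsto_one_div_add_atTop_nhds_zero_nat (𝕜 := ℝ)).eventually_lt_const
          (sub_pos.2 hx)
        filter_upwards [this] with n hn
        rw [max_eq_left (by linarith), max_eq_left (by linarith)]
        field_simp
        ring
      · rw [indicator_of_notMem (by simpa using hx)]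
        refine tendsto_const_nhds.congr fun n => ?_
        have he : (0 : ℝ) < 1 / ((n : ℝ) + 1) := by positivity
        rw [max_eq_right (by linarith), max_eq_right (by linarith)]
        simp
  have hreal : ∀ c : ℝ, μ.real (Ioi c) = ν.real (Ioi c) := fun c =>
    tendsto_nhds_unique (lim μ hμ c) (by simpa only [h] using lim ν hν c)
  refine ext_of_generate_finite _ (borel_eq_generateFrom_Ioi ℝ ▸ BorelSpace.measurable_eq)
    isPiSystem_Ioi ?_ ?_
  · rintro _ ⟨c, rfl⟩
    exact (measureReal_eq_measureReal_iff).1 (hreal c)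
  -- Equality of total masses is not assumed; it follows by exhausting the line with rays.
  · have hU : (univ : Set ℝ) = ⋃ n : ℕ, Ioi (-(n : ℝ)) := by
      refine (eq_univ_of_forall fun x => ?_).symm
      obtain ⟨n, hn⟩ := exists_nat_gt (-x)
      exact mem_iUnion.2 ⟨n, by simp only [mem_Ioi]; linarith⟩
    have hm : Monotone fun n : ℕ => Ioi (-(n : ℝ)) := fun m n hmn =>
      Ioi_subset_Ioi (by simpa using hmn)
    rw [hU, hm.measure_iUnion, hm.measure_iUnion]
    exact iSup_congr fun n => (measureReal_eq_measureReal_iff).1 (hreal _)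

/-! ### The law of the normalized likelihood and the divergences it expresses -/

section Likelihood

variable {α : Type*} [MeasurableSpace α] (P Q : Measure α)

theorem measurable_likelihood : Measurable (likelihood P Q) :=
  (Measure.measurable_rnDeriv _ _).ennreal_toReal

theorem absolutelyContinuous_add_right : P ≪ P + Q :=
  (Measure.le_add_right le_rfl).absolutelyContinuous

theorem absolutelyContinuous_add_left : Q ≪ P + Q :=
  (Measure.le_add_left le_rfl).absolutelyContinuous

theorem integral_likelihoodLaw {g : ℝ → ℝ} (hg : Measurable g) :
    ∫ x, g x ∂(likelihoodLaw P Q) = ∫ x, g (likelihood P Q x) ∂(P + Q) :=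
  integral_map (measurable_likelihood P Q).aemeasurable hg.aestronglyMeasurable

theorem integrable_likelihood [IsFiniteMeasure P] : Integrable (likelihood P Q) (P + Q) :=
  Measure.integrable_toReal_rnDeriv

theorem integrable_id_likelihoodLaw [IsFiniteMeasure P] :
    Integrable (fun x : ℝ => x) (likelihoodLaw P Q) := by
  unfold likelihoodLaw
  rw [integrable_map_measure (by fun_prop) (measurable_likelihood P Q).aemeasurable]
  exact integrable_likelihood P Q

variable [IsProbabilityMeasure P] [IsProbabilityMeasure Q]

instance isFiniteMeasure_likelihoodLaw : IsFiniteMeasure (likelihoodLaw P Q) := by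
  unfold likelihoodLaw; infer_instance

theorem rnDeriv_right_eq_one_sub_likelihood :
    ∀ᵐ x ∂(P + Q), (Q.rnDeriv (P + Q) x).toReal = 1 - likelihood P Q x := by
  filter_upwards [Measure.rnDeriv_add' P Q (P + Q), Measure.rnDeriv_self (P + Q),
    Measure.rnDeriv_lt_top P (P + Q), Measure.rnDeriv_lt_top Q (P + Q)] with x h1 h2 h3 h4
  have h := congrArg ENNReal.toReal (h1.symm.trans h2)
  rw [Pi.add_apply, ENNReal.toReal_add h3.ne h4.ne, ENNReal.toReal_one] at h
  unfold likelihood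
  linarith

variable {P Q}

/-- Each density is positive almost everywhere for its own measure, and P+Q is absolutely continuous
with respect to both. The boundary conventions in `persp` therefore never matter. -/
theorem likelihood_mem_Ioo (hPQ : P ≪ Q) (hQP : Q ≪ P) :
    ∀ᵐ x ∂(P + Q), likelihood P Q x ∈ Ioo (0 : ℝ) 1 := by
  have hP : P + Q ≪ P := Measure.AbsolutelyContinuous.add_left Measure.AbsolutelyContinuous.rfl hQP
  have hQ : P + Q ≪ Q := Measure.AbsolutelyContinuous.add_left hPQ Measure.AbsolutelyContinuous.rfl
  filter_upwards [rnDeriv_right_eq_one_sub_likelihood P Q,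
    hP.ae_le (Measure.rnDeriv_pos (absolutelyContinuous_add_right P Q)),
    hQ.ae_le (Measure.rnDeriv_pos (absolutelyContinuous_add_left P Q)),
    Measure.rnDeriv_lt_top P (P + Q), Measure.rnDeriv_lt_top Q (P + Q)] with x h1 h2 h3 h4 h5
  have h6 : 0 < likelihood P Q x := ENNReal.toReal_pos h2.ne' h4.ne
  have h7 : 0 < (Q.rnDeriv (P + Q) x).toReal := ENNReal.toReal_pos h3.ne' h5.ne
  exact ⟨h6, by linarith⟩

variable (P Q)

theorem setIntegral_likelihood (U : Set α) :
    ∫ x in U, likelihood P Q x ∂(P + Q) = P.real U :=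
  Measure.setIntegral_toReal_rnDeriv (absolutelyContinuous_add_right P Q) U

theorem setIntegral_one_sub_likelihood (U : Set α) :
    ∫ x in U, (1 - likelihood P Q x) ∂(P + Q) = Q.real U := by
  rw [← Measure.setIntegral_toReal_rnDeriv (absolutelyContinuous_add_left P Q) U]
  exact integral_congr_ae (ae_restrict_of_ae
    ((rnDeriv_right_eq_one_sub_likelihood P Q).mono fun x hx => hx.symm))

theorem integral_likelihood : ∫ x, likelihood P Q x ∂(P + Q) = 1 := by
  simpa using setIntegral_likelihood P Q univ

theorem integral_likelihoodLaw_id : ∫ x, x ∂(likelihoodLaw P Q) = 1 :=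
  (integral_likelihoodLaw P Q measurable_id).trans (integral_likelihood P Q)

theorem likelihoodLaw_real_univ : (likelihoodLaw P Q).real univ = 2 := by
  unfold likelihoodLaw
  rw [map_measureReal_apply (measurable_likelihood P Q) MeasurableSet.univ, preimage_univ,
    measureReal_add_apply]
  norm_num

variable {P Q}

theorem likelihoodLaw_mem_Ioo (hPQ : P ≪ Q) (hQP : Q ≪ P) :
    ∀ᵐ x ∂(likelihoodLaw P Q), x ∈ Ioo (0 : ℝ) 1 := by
  unfold likelihoodLaw
  exact (ae_map_iff (measurable_likelihood P Q).aemeasurable measurableSet_Ioo).2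
    (likelihood_mem_Ioo hPQ hQP)

/-- The `f`-divergence as an integral against the law of the normalized likelihood. -/
theorem fDivergence_eq_extIntegral_likelihoodLaw {f : ℝ → ℝ} (hf : ContinuousOn f (Ioi 0))
    (hPQ : P ≪ Q) (hQP : Q ≪ P) :
    fDivergence f P Q = extIntegral (likelihoodLaw P Q)
      (fun x => (((Ioo (0 : ℝ) 1).indicator (fun x => (1 - x) * f (x / (1 - x))) x : ℝ) : EReal)) := by
  have hc : ContinuousOn (fun x : ℝ => (1 - x) * f (x / (1 - x))) (Ioo 0 1) := by
    refine ContinuousOn.mul (by fun_prop) (hf.comp ?_ ?_)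
    · exact continuousOn_id.div (by fun_prop) fun x hx => (sub_pos.2 hx.2).ne'
    · exact fun x hx => div_pos hx.1 (sub_pos.2 hx.2)
  -- Nothing is known about `f` off (0,∞); cutting off by the indicator makes the integrand
  -- measurable on the whole line.
  have hm : Measurable ((Ioo (0 : ℝ) 1).indicator fun x => (1 - x) * f (x / (1 - x))) := by
    classical
    have := hc.measurable_piecewise (g := fun _ => (0 : ℝ)) (by fun_prop) measurableSet_Ioo
    rwa [show (fun _ : ℝ => (0 : ℝ)) = 0 from rfl, piecewise_eq_indicator] at this
  unfold likelihoodLaw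
  rw [extIntegral_map (measurable_likelihood P Q) hm.coe_real_ereal]
  refine extIntegral_congr_ae ?_
  filter_upwards [rnDeriv_right_eq_one_sub_likelihood P Q, likelihood_mem_Ioo hPQ hQP] with x h1 h2
  rw [h1, indicator_of_mem h2]
  change persp f (likelihood P Q x) _ = _
  rw [persp, if_neg (sub_pos.2 h2.2).ne', if_neg h2.1.ne']

variable (P Q)

/-- The `E_γ` divergence as an integral of a positive part. -/
theorem eGamma_eq_integral (γ : ℝ) :
    eGamma γ P Q = ∫ x, max (likelihood P Q x - γ * (1 - likelihood P Q x)) 0 ∂(P + Q) := by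
  set g : α → ℝ := fun x => likelihood P Q x - γ * (1 - likelihood P Q x) with hg
  have hp := integrable_likelihood P Q
  have hq : Integrable (fun x => 1 - likelihood P Q x) (P + Q) := (integrable_const 1).sub hp
  have hgi : Integrable g (P + Q) := hp.sub (hq.const_mul γ)
  have hgm : Measurable g := by
    have := measurable_likelihood P Q
    fun_prop
  have hset : ∀ U : Set α, P.real U - γ * Q.real U = ∫ x in U, g x ∂(P + Q) := by
    intro U
    rw [hg, integral_sub hp.integrableOn (hq.const_mul γ).integrableOn, integral_const_mul,
      setIntegral_likelihood, setIntegral_one_sub_likelihood]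
  have hle : ∀ U : Set α, P.real U - γ * Q.real U ≤ ∫ x, max (g x) 0 ∂(P + Q) := by
    intro U
    rw [hset]
    calc ∫ x in U, g x ∂(P + Q) ≤ ∫ x in U, max (g x) 0 ∂(P + Q) :=
          integral_mono hgi.integrableOn hgi.pos_part.integrableOn fun x => le_max_left _ _
      _ ≤ _ := setIntegral_le_integral hgi.pos_part (ae_of_all _ fun x => le_max_right _ _)
  unfold eGamma
  refine le_antisymm (ciSup_le fun U => hle U) ?_
  -- The likelihood-ratio event {g > 0} attains the supremum.
  have hU : MeasurableSet {x | 0 < g x} := measurableSet_lt measurable_const hgm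
  refine le_of_eq_of_le ?_ (le_ciSup
    (f := fun U : {U : Set α // MeasurableSet U} => P.real U.1 - γ * Q.real U.1)
    ⟨_, forall_mem_range.2 fun U => hle U.1⟩ ⟨_, hU⟩)
  simp only [hset]
  rw [← integral_indicator hU]
  refine integral_congr_ae (ae_of_all _ fun x => ?_)
  by_cases hx : 0 < g x
  · rw [indicator_of_mem (by exact hx)]; exact max_eq_left hx.le
  · rw [indicator_of_notMem (by exact hx)]; exact max_eq_right (not_lt.1 hx)

/-- This rests on x - γ(1-x) = (1+γ)(x - γ/(1+γ)). -/
theorem eGamma_eq_mul_integral_likelihoodLaw {γ : ℝ} (hγ : 0 < 1 + γ) :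
    eGamma γ P Q = (1 + γ) * ∫ x, max (x - γ / (1 + γ)) 0 ∂(likelihoodLaw P Q) := by
  rw [integral_likelihoodLaw P Q (by fun_prop), ← integral_const_mul, eGamma_eq_integral]
  congr 1 with x
  rw [mul_max_of_nonneg _ _ hγ.le]
  congr 1
  · field_simp
    ring
  · simp

/-- Exchanging P and Q replaces X by 1-X, so (x-(1-c))⁺ becomes (c-x)⁺. Moreover (x-c)⁺ - (c-x)⁺ =
x-c, whose integral is 1-2c since the law has mass 2 and first moment 1. -/
theorem integral_max_sub_swap (c : ℝ) :
    ∫ x, max (x - c) 0 ∂(likelihoodLaw P Q) =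
      (∫ x, max (x - (1 - c)) 0 ∂(likelihoodLaw Q P)) + (1 - 2 * c) := by
  have hi := integrable_id_likelihoodLaw P Q
  have hl : ∫ x, max (x - (1 - c)) 0 ∂(likelihoodLaw Q P) =
      ∫ x, max (c - x) 0 ∂(likelihoodLaw P Q) := by
    rw [integral_likelihoodLaw Q P (by fun_prop), integral_likelihoodLaw P Q (by fun_prop),
      add_comm Q P]
    refine integral_congr_ae ?_
    filter_upwards [rnDeriv_right_eq_one_sub_likelihood P Q] with x hx
    have : likelihood Q P x = 1 - likelihood P Q x := by
      rw [← hx, likelihood, add_comm Q P]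
    rw [this]
    congr 1
    ring
  have hi2 : Integrable (fun x : ℝ => x - c) (likelihoodLaw P Q) := hi.sub (integrable_const c)
  have hi' : Integrable (fun x : ℝ => max (c - x) 0) (likelihoodLaw P Q) :=
    ((integrable_const c).sub hi).pos_part
  have hs : (∫ x, (x - c) ∂(likelihoodLaw P Q)) = 1 - 2 * c := by
    rw [integral_sub hi (integrable_const c), integral_likelihoodLaw_id, integral_const,
      likelihoodLaw_real_univ, smul_eq_mul]
  rw [hl, ← hs, ← integral_add hi' hi2]
  congr 1 with x
  rcases max_cases (x - c) 0 with h | h <;> rcases max_cases (c - x) 0 with h' | h' <;> linarith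

variable {P Q}

theorem integral_max_sub_of_nonpos (hPQ : P ≪ Q) (hQP : Q ≪ P) {c : ℝ} (hc : c ≤ 0) :
    ∫ x, max (x - c) 0 ∂(likelihoodLaw P Q) = 1 - 2 * c := by
  have hs : (∫ x, (x - c) ∂(likelihoodLaw P Q)) = 1 - 2 * c := by
    rw [integral_sub (integrable_id_likelihoodLaw P Q) (integrable_const c),
      integral_likelihoodLaw_id, integral_const, likelihoodLaw_real_univ, smul_eq_mul]
  rw [← hs]
  refine integral_congr_ae ((likelihoodLaw_mem_Ioo hPQ hQP).mono fun x hx => ?_)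
  exact max_eq_left (by linarith [hx.1])

theorem integral_max_sub_of_one_le (hPQ : P ≪ Q) (hQP : Q ≪ P) {c : ℝ} (hc : 1 ≤ c) :
    ∫ x, max (x - c) 0 ∂(likelihoodLaw P Q) = 0 := by
  refine integral_eq_zero_of_ae ((likelihoodLaw_mem_Ioo hPQ hQP).mono fun x hx => ?_)
  exact max_eq_right (by linarith [hx.2])

/-- Since ωx - (1-ω)(1-x) = x-(1-ω), one has min(ωx, (1-ω)(1-x)) = ωx - (x-(1-ω))⁺. Hence (1-x)
φ_ω(x/(1-x)) is an affine function, with known integral, plus (x-(1-ω))⁺. -/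
theorem deGrootInfo_eq (hPQ : P ≪ Q) (hQP : Q ≪ P) (ω : ℝ) :
    deGrootInfo ω P Q = ((min ω (1 - ω) - ω +
      ∫ x, max (x - (1 - ω)) 0 ∂(likelihoodLaw P Q) : ℝ) : EReal) := by
  have hc : ContinuousOn (deGrootFun ω) (Ioi 0) := by
    unfold deGrootFun
    fun_prop
  have hi := integrable_id_likelihoodLaw P Q
  have hmax : Integrable (fun x : ℝ => max (x - (1 - ω)) 0) (likelihoodLaw P Q) :=
    (hi.sub (integrable_const _)).pos_part
  have hsub : Integrable (fun x : ℝ => 1 - x) (likelihoodLaw P Q) := (integrable_const 1).sub hi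
  have hlin : Integrable (fun x : ℝ => min ω (1 - ω) * (1 - x) - ω * x) (likelihoodLaw P Q) :=
    (hsub.const_mul _).sub (hi.const_mul _)
  have hadd : Integrable (fun x : ℝ => min ω (1 - ω) * (1 - x) - ω * x + max (x - (1 - ω)) 0)
      (likelihoodLaw P Q) := hlin.add hmax
  have hval : min ω (1 - ω) - ω =
      ∫ x, (min ω (1 - ω) * (1 - x) - ω * x) ∂(likelihoodLaw P Q) := by
    rw [integral_sub (hsub.const_mul _) (hi.const_mul _),
      integral_const_mul, integral_const_mul, integral_sub (integrable_const 1) hi,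
      integral_likelihoodLaw_id, integral_const, likelihoodLaw_real_univ, smul_eq_mul]
    ring
  rw [deGrootInfo, fDivergence_eq_extIntegral_likelihoodLaw hc hPQ hQP, hval,
    ← integral_add hlin hmax, ← extIntegral_coe_of_integrable hadd]
  refine extIntegral_congr_ae ((likelihoodLaw_mem_Ioo hPQ hQP).mono fun x hx => ?_)
  have h1 : 0 < 1 - x := sub_pos.2 hx.2
  have h2 : (1 - x) * min (ω * (x / (1 - x))) (1 - ω) = min (ω * x) ((1 - x) * (1 - ω)) := by
    rw [mul_min_of_nonneg _ _ h1.le]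
    congr 1
    field_simp
  simp only [indicator_of_mem hx, EReal.coe_eq_coe_iff, deGrootFun]
  rw [mul_sub, h2]
  rcases min_cases (ω * x) ((1 - x) * (1 - ω)) with h | h <;>
    rcases max_cases (x - (1 - ω)) 0 with h' | h' <;> linarith

end Likelihood

/-! ### From equal divergences to equal laws -/

/-- Equality of the integrals of `(x - c)⁺` for `0 < c < 1` determines the law of the normalized
likelihood, hence every `f`-divergence. -/
theorem fDivergence_eq_of_integral_max_sub {α β : Type*} [MeasurableSpace α] [MeasurableSpace β]
    {f : ℝ → ℝ} (hf : ContinuousOn f (Ioi 0))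
    {P Q : Measure α} [IsProbabilityMeasure P] [IsProbabilityMeasure Q]
    (hPQ : P ≪ Q) (hQP : Q ≪ P)
    {P' Q' : Measure β} [IsProbabilityMeasure P'] [IsProbabilityMeasure Q']
    (hPQ' : P' ≪ Q') (hQP' : Q' ≪ P')
    (h : ∀ c ∈ Ioo (0 : ℝ) 1, ∫ x, max (x - c) 0 ∂(likelihoodLaw P Q) =
      ∫ x, max (x - c) 0 ∂(likelihoodLaw P' Q')) :
    fDivergence f P Q = fDivergence f P' Q' := by
  have hlaw : likelihoodLaw P Q = likelihoodLaw P' Q' := by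
    refine measure_eq_of_integral_max_sub (integrable_id_likelihoodLaw P Q)
      (integrable_id_likelihoodLaw P' Q') fun c => ?_
    rcases le_or_gt c 0 with h0 | h0
    · rw [integral_max_sub_of_nonpos hPQ hQP h0, integral_max_sub_of_nonpos hPQ' hQP' h0]
    rcases le_or_gt 1 c with h1 | h1
    · rw [integral_max_sub_of_one_le hPQ hQP h1, integral_max_sub_of_one_le hPQ' hQP' h1]
    exact h c ⟨h0, h1⟩
  rw [fDivergence_eq_extIntegral_likelihoodLaw hf hPQ hQP,
    fDivergence_eq_extIntegral_likelihoodLaw hf hPQ' hQP', hlaw]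

theorem integral_max_sub_eq_of_eGamma_eq {α β : Type*} [MeasurableSpace α] [MeasurableSpace β]
    {P Q : Measure α} [IsProbabilityMeasure P] [IsProbabilityMeasure Q]
    {P' Q' : Measure β} [IsProbabilityMeasure P'] [IsProbabilityMeasure Q']
    (h : ∀ γ : ℝ, 1 ≤ γ → eGamma γ P Q = eGamma γ P' Q') {c : ℝ} (hc : 1 / 2 ≤ c) (hc1 : c < 1) :
    ∫ x, max (x - c) 0 ∂(likelihoodLaw P Q) = ∫ x, max (x - c) 0 ∂(likelihoodLaw P' Q') := by
  have h1 : 0 < 1 - c := sub_pos.2 hc1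
  -- γ = c/(1-c) solves c = γ/(1+γ), and γ ≥ 1 exactly when c ≥ 1/2.
  have hγ : 1 ≤ c / (1 - c) := by rw [le_div_iff₀ h1]; linarith
  have hpos : 0 < 1 + c / (1 - c) := by linarith
  have hcγ : c / (1 - c) / (1 + c / (1 - c)) = c := by
    field_simp
    ring
  have := h _ hγ
  rw [eGamma_eq_mul_integral_likelihoodLaw P Q hpos,
    eGamma_eq_mul_integral_likelihoodLaw P' Q' hpos, hcγ] at this
  exact mul_left_cancel₀ hpos.ne' this

theorem corollary1 {α β : Type*} [MeasurableSpace α] [MeasurableSpace β]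
    (f : ℝ → ℝ) (hf : DivergenceFun f) (hf' : DifferentiableOn ℝ f (Ioi 0))
    (P Q : Measure α) [IsProbabilityMeasure P] [IsProbabilityMeasure Q]
    (hPQ : P ≪ Q) (hQP : Q ≪ P)
    (P' Q' : Measure β) [IsProbabilityMeasure P'] [IsProbabilityMeasure Q']
    (hPQ' : P' ≪ Q') (hQP' : Q' ≪ P') :
    ((∀ γ : ℝ, 1 ≤ γ → (eGamma γ P Q, eGamma γ Q P) = (eGamma γ P' Q', eGamma γ Q' P')) →
      fDivergence f P Q = fDivergence f P' Q') ∧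
    ((∀ ω ∈ Ioo (0 : ℝ) 1, deGrootInfo ω P Q = deGrootInfo ω P' Q') →
      fDivergence f P Q = fDivergence f P' Q') := by
  have hc : ContinuousOn f (Ioi 0) := hf'.continuousOn
  refine ⟨fun h => ?_, fun h => ?_⟩
  · refine fDivergence_eq_of_integral_max_sub hc hPQ hQP hPQ' hQP' fun c hc => ?_
    rcases le_or_gt (1 / 2) c with h2 | h2
    · exact integral_max_sub_eq_of_eGamma_eq (fun γ hγ => (Prod.ext_iff.1 (h γ hγ)).1) h2 hc.2
    -- For c < 1/2 the swapped divergence is used at the threshold 1-c > 1/2.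
    · rw [integral_max_sub_swap P Q, integral_max_sub_swap P' Q',
        integral_max_sub_eq_of_eGamma_eq (fun γ hγ => (Prod.ext_iff.1 (h γ hγ)).2)
          (by linarith) (by linarith [hc.1])]
  · refine fDivergence_eq_of_integral_max_sub hc hPQ hQP hPQ' hQP' fun c hc => ?_
    have := h (1 - c) ⟨by linarith [hc.2], by linarith [hc.1]⟩
    rw [deGrootInfo_eq hPQ hQP, deGrootInfo_eq hPQ' hQP', EReal.coe_eq_coe_iff,
      sub_sub_cancel] at this
    linarith
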